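/- Let $R$ and $A$ be finite-dimensional complex Hilbert spaces, let $n\ge 1$ be an integer, and let $\rho^{RA}$ and $\sigma^A$ be density operators on $R\otimes A$ and on $A$, respectively. Write $\rho^R=\mathrm{Tr}_A\,\rho^{RA}$ and $A^n=A_1\otimes\cdots\otimes A_n$ with every $A_x$ a copy of $A$, and put $$\tau^{RA^n}=\frac1n\sum_{x=1}^n \rho^{RA_x}\otimes\bigotimes_{y\neq x}\sigma^{A_y}.$$ For density operators $\alpha,\beta$ on the same space let $F(\alpha,\beta)=\|\sqrt\alpha\sqrt\beta\|_1$ be the fidelity and $P(\alpha,\beta)=\sqrt{1-F(\alpha,\beta)^2}$ the purified distance, and let $$Q_2(\alpha\|\beta)=\mathrm{Tr}\Big[\big(\beta^{-1/4}\alpha\,\beta^{-1/4}\big)^2\Big]$$ if the support of $\alpha$ is contained in the support of $\beta$ (negative powers being taken on the support of $\beta$), and $Q_2(\alpha\|\beta)=\infty$ otherwise. Define $$\nu_n=\min_{\omega^R}\Big\{\frac{n-1}{n}\,Q_2(\rho^R\|\omega^R)+\frac1n\,Q_2(\rho^{RA}\|\omega^R\otimes\sigma^A)\Big\},$$ where $\omega^R$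 ranges over all density operators on $R$ (and $0\cdot\infty=0$). Then the minimum is attained in $[1,\infty]$, and $$P^2\big(\tau^{RA^n},\,\rho^R\otimes(\sigma^A)^{\otimes n}\big)\le 1-\frac1{\nu_n},$$ where $1/\infty=0$. Consequently, if $Q_2(\rho^{RA}\|\rho^R\otimes\sigma^A)<\infty$ and $\mu=Q_2(\rho^{RA}\|\rho^R\otimes\sigma^A)-1$, then $$P^2\big(\tau^{RA^n},\,\rho^R\otimes(\sigma^A)^{\otimes n}\big)\le\frac{\mu}{\mu+n}.$$ -/

import Mathlib

open scoped Kronecker ENNReal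

namespace ConvexSplit

open Matrix
open scoped ComplexOrder MatrixOrder Matrix.Norms.L2Operator

noncomputable section

/-- A density operator on the finite-dimensional Hilbert space with orthonormal basis `ι`. -/
def IsDensity {ι : Type*} [Fintype ι] (ρ : Matrix ι ι ℂ) : Prop :=
  ρ.PosSemidef ∧ ρ.trace = 1

/-- The support of a Hermitian operator: its range (the orthogonal complement of its kernel). -/
def supp {ι : Type*} [Fintype ι] (M : Matrix ι ι ℂ) : Submodule ℂ (ι → ℂ) :=
  LinearMap.range M.mulVecLin

/-- The trace norm `‖M‖₁ = Tr √(M* M)`. -/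
def traceNorm {ι : Type*} [Fintype ι] [DecidableEq ι] (M : Matrix ι ι ℂ) : ℝ :=
  (CFC.sqrt (Mᴴ * M)).trace.re

/-- The fidelity `F(ρ, σ) = ‖√ρ √σ‖₁`. -/
def fidelity {ι : Type*} [Fintype ι] [DecidableEq ι] (ρ σ : Matrix ι ι ℂ) : ℝ :=
  traceNorm (CFC.sqrt ρ * CFC.sqrt σ)

/-- The purified distance `P(ρ, σ) = √(1 - F(ρ, σ)²)`. -/
def purifiedDist {ι : Type*} [Fintype ι] [DecidableEq ι] (ρ σ : Matrix ι ι ℂ) : ℝ :=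
  Real.sqrt (1 - fidelity ρ σ ^ 2)

open Classical in
/-- `Q₂(ρ‖σ) = Tr (σ^(-1/4) ρ σ^(-1/4))²` if the support of `ρ` lies in the support of `σ`, and
`Q₂(ρ‖σ) = ∞` otherwise. Since `0 ^ (-1/4) = 0` in the functional calculus, the negative power
of `σ` is taken on the support of `σ`. -/
def Q2 {ι : Type*} [Fintype ι] [DecidableEq ι] (ρ σ : Matrix ι ι ℂ) : ℝ≥0∞ :=
  if supp ρ ≤ supp σ then
    ENNReal.ofReal (((σ ^ (-1 / 4 : ℝ) * ρ * σ ^ (-1 / 4 : ℝ)) ^ 2).trace.re)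
  else ⊤

/-- The marginal `ρ^R = Tr_A ρ^{RA}`. -/
def marginal {r a : Type*} [Fintype a] (ρ : Matrix (r × a) (r × a) ℂ) : Matrix r r ℂ :=
  Matrix.of fun i j => ∑ k, ρ (i, k) (j, k)

/-- The tensor power `σ^{⊗n}` on `A^n`, whose product basis is `Fin n → a`. -/
def tensorPow {a : Type*} (n : ℕ) (σ : Matrix a a ℂ) : Matrix (Fin n → a) (Fin n → a) ℂ :=
  Matrix.of fun f g => ∏ y, σ (f y) (g y)

/-- The state `τ_x` on `RA^n`: `ρ` on `R A_x`, tensored with `σ` on every other copy of `A`. -/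
def tauAt {r a : Type*} (n : ℕ) (ρ : Matrix (r × a) (r × a) ℂ) (σ : Matrix a a ℂ) (x : Fin n) :
    Matrix (r × (Fin n → a)) (r × (Fin n → a)) ℂ :=
  Matrix.of fun p q =>
    ρ (p.1, p.2 x) (q.1, q.2 x) * ∏ y ∈ Finset.univ.erase x, σ (p.2 y) (q.2 y)

/-- The uniform mixture `τ = (1/n) ∑ₓ τ_x`. -/
def tau {r a : Type*} (n : ℕ) (ρ : Matrix (r × a) (r × a) ℂ) (σ : Matrix a a ℂ) :
    Matrix (r × (Fin n → a)) (r × (Fin n → a)) ℂ :=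
  (1 / (n : ℂ)) • ∑ x, tauAt n ρ σ x

/-- `((n-1)/n) Q₂(ρ^R‖ω^R) + (1/n) Q₂(ρ^{RA}‖ω^R ⊗ σ^A)`, for `n ≥ 1`. -/
def splitValue {r a : Type*} [Fintype r] [DecidableEq r] [Fintype a] [DecidableEq a]
    (n : ℕ) (ρ : Matrix (r × a) (r × a) ℂ) (σ : Matrix a a ℂ) (ω : Matrix r r ℂ) : ℝ≥0∞ :=
  ((n : ℝ≥0∞) - 1) / n * Q2 (marginal ρ) ω + 1 / n * Q2 ρ (ω ⊗ₖ σ)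

/-- `ν_n`, the infimum of `splitValue n ρ σ ω` over all density operators `ω` on `R`. -/
def nu {r a : Type*} [Fintype r] [DecidableEq r] [Fintype a] [DecidableEq a]
    (n : ℕ) (ρ : Matrix (r × a) (r × a) ℂ) (σ : Matrix a a ℂ) : ℝ≥0∞ :=
  ⨅ ω ∈ {ω : Matrix r r ℂ | IsDensity ω}, splitValue n ρ σ ω

/-- `μ = Q₂(ρ^{RA}‖ρ^R ⊗ σ^A) - 1`, meaningful where that `Q₂` is finite. -/
def mu {r a : Type*} [Fintype r] [DecidableEq r] [Fintype a] [DecidableEq a]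
    (ρ : Matrix (r × a) (r × a) ℂ) (σ : Matrix a a ℂ) : ℝ :=
  (Q2 ρ (marginal ρ ⊗ₖ σ)).toReal - 1

end

end ConvexSplit

/-! Write `m` for the `R`-marginal of a state `α` on `R ⊗ B`, and `G = Tr α^{1/2} (m ⊗ s)^{1/2}`.
The core is `one_le_overlap_mul_collision`: whenever `α` is supported in `ω ⊗ s`, `1 ≤ G² Q₂(α‖ω ⊗
s)`. It follows from Cauchy–Schwarz alone, through `1 ≤ Tr(m^{5/4} ω^{-1/4})² ≤ G · Tr(α^{3/2} (ω ⊗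
s)^{-1/2})` and `Tr(α^{3/2} β^{-1/2})² ≤ Q₂(α‖β)`. The middle trace, first written on `R ⊗ B`, loses
every trace of `s` because opposite powers cancel on the support, so only the marginal remains.

For `α = τ` and `s = σ^{⊗n}`, expanding the square in `Q₂` gives `n` diagonal terms `Q₂(ρ^{RA}‖ω ⊗
σ)` and `n(n-1)` cross terms `Q₂(ρ^R‖ω)`; dividing by `n²` yields exactly `splitValue`
(`trace_tau_collision`). Since `G ≤ F`, this bounds `P²` for every `ω`, and `G ≤ 1` gives `1 ≤ ν_n`.
Taking `ω = ρ^R` gives the value `(μ + n) / n` and the last claim.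

The minimum exists because `Q₂` is a supremum of functions continuous in the square root of its
second argument, hence lower semicontinuous, and the square roots of states form a compact set. -/

open scoped Kronecker ENNReal

namespace ConvexSplit

open Matrix
open scoped ComplexOrder MatrixOrder Matrix.Norms.L2Operator

set_option linter.unusedSectionVars false

/-! ### Real powers and support projections of positive matrices -/

section Powers

variable {ι κ : Type*} [Fintype ι] [DecidableEq ι] [Fintype κ] [DecidableEq κ]

/-- Any unitary diagonalization of a positive matrix computes its real powers. -/
theorem rpow_conj_diagonal {U : Matrix ι ι ℂ} (hU : U ∈ unitaryGroup ι ℂ) {d : ι → ℝ}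
    (hd : ∀ i, 0 ≤ d i) (t : ℝ) :
    (U * diagonal (fun i => (d i : ℂ)) * Uᴴ) ^ t =
      U * diagonal (fun i => ((d i ^ t : ℝ) : ℂ)) * Uᴴ := by
  have hUU : Uᴴ * U = 1 := mem_unitaryGroup_iff'.1 hU
  have hUU' : U * Uᴴ = 1 := mem_unitaryGroup_iff.1 hU
  set A := U * diagonal (fun i => (d i : ℂ)) * Uᴴ with hA
  have hpos : A.PosSemidef := by
    have : (diagonal (fun i => (d i : ℂ))).PosSemidef :=
      posSemidef_diagonal_iff.2 fun i => by exact_mod_cast hd i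
    exact this.mul_mul_conjTranspose_same U
  rw [CFC.rpow_eq_cfc_real (ha := hpos.nonneg), hpos.1.cfc_eq, IsHermitian.cfc,
    Unitary.conjStarAlgAut_apply]
  have hs := hpos.1.spectral_theorem
  rw [Unitary.conjStarAlgAut_apply] at hs
  set V : Matrix ι ι ℂ := (hpos.1.eigenvectorUnitary : Matrix ι ι ℂ)
  set l := hpos.1.eigenvalues
  have hVV : star V * V = 1 := mem_unitaryGroup_iff'.1 hpos.1.eigenvectorUnitary.2
  have hVV' : V * star V = 1 := mem_unitaryGroup_iff.1 hpos.1.eigenvectorUnitary.2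
  -- The change of basis between two diagonalizations intertwines the diagonals, so its nonzero
  -- entries join equal eigenvalues; hence it also intertwines their `t`-th powers.
  have hcomm : diagonal (RCLike.ofReal ∘ l : ι → ℂ) * (star V * U) =
      (star V * U) * diagonal (fun i => (d i : ℂ)) := by
    have h1 : star V * A * U = diagonal (RCLike.ofReal ∘ l : ι → ℂ) * (star V * U) := by
      rw [hs]
      simp only [← Matrix.mul_assoc]
      rw [hVV, Matrix.one_mul]
    have h2 : star V * A * U = (star V * U) * diagonal (fun i => (d i : ℂ)) := by
      rw [hA]
      simp only [Matrix.mul_assoc]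
      rw [hUU, Matrix.mul_one]
    rw [← h1, h2]
  have hcomm' : diagonal (RCLike.ofReal ∘ (fun x : ℝ => x ^ t) ∘ l : ι → ℂ) * (star V * U) =
      (star V * U) * diagonal (fun i => ((d i ^ t : ℝ) : ℂ)) := by
    ext i j
    have := congrFun (congrFun hcomm i) j
    rw [diagonal_mul, mul_diagonal] at this ⊢
    by_cases h : (star V * U) i j = 0
    · simp [h]
    · have h3 : l i = d j := by
        rw [mul_comm] at this
        exact Complex.ofReal_injective (mul_left_cancel₀ h this)
      simp [h3, mul_comm]
  calc V * diagonal (RCLike.ofReal ∘ (fun x : ℝ => x ^ t) ∘ l : ι → ℂ) * star V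
      = V * (diagonal (RCLike.ofReal ∘ (fun x : ℝ => x ^ t) ∘ l : ι → ℂ) * (star V * U)) * Uᴴ := by
        simp only [Matrix.mul_assoc]; rw [hUU', Matrix.mul_one]
    _ = _ := by
        rw [hcomm']
        simp only [← Matrix.mul_assoc]; rw [hVV', Matrix.one_mul]

theorem exists_diagonalization {A : Matrix ι ι ℂ} (hA : A.PosSemidef) :
    ∃ U ∈ unitaryGroup ι ℂ, ∃ d : ι → ℝ, (∀ i, 0 ≤ d i) ∧
      A = U * diagonal (fun i => (d i : ℂ)) * Uᴴ :=
  ⟨hA.1.eigenvectorUnitary, hA.1.eigenvectorUnitary.2, hA.1.eigenvalues, hA.eigenvalues_nonneg, by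
    have := hA.1.spectral_theorem
    rwa [Unitary.conjStarAlgAut_apply] at this⟩

theorem posSemidef_rpow (A : Matrix ι ι ℂ) (t : ℝ) : (A ^ t).PosSemidef :=
  (CFC.rpow_nonneg (a := A) (y := t)).posSemidef

theorem conjTranspose_rpow (A : Matrix ι ι ℂ) (t : ℝ) : (A ^ t)ᴴ = A ^ t :=
  (posSemidef_rpow A t).1

theorem conj_diagonal_mul {U : Matrix ι ι ℂ} (hU : U ∈ unitaryGroup ι ℂ) (d e : ι → ℂ) :
    U * diagonal d * Uᴴ * (U * diagonal e * Uᴴ) = U * diagonal (fun i => d i * e i) * Uᴴ := by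
  have hUU : Uᴴ * U = 1 := mem_unitaryGroup_iff'.1 hU
  calc _ = U * diagonal d * (Uᴴ * U) * diagonal e * Uᴴ := by simp only [Matrix.mul_assoc]
    _ = _ := by rw [hUU, Matrix.mul_one, Matrix.mul_assoc U, diagonal_mul_diagonal]

/-- The condition `u ≠ 0` is for zero eigenvalues: then `s` or `t` is nonzero and both sides vanish
there, whereas `0 ^ 0 = 1`. -/
theorem rpow_mul_rpow {A : Matrix ι ι ℂ} (hA : A.PosSemidef) {s t u : ℝ} (h : s + t = u)
    (hu : u ≠ 0) : A ^ s * A ^ t = A ^ u := by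
  obtain ⟨U, hU, d, hd, rfl⟩ := exists_diagonalization hA
  subst h
  simp only [rpow_conj_diagonal hU hd, conj_diagonal_mul hU]
  congr 3
  ext i
  rw [Real.rpow_add' (hd i) hu]
  simp

theorem rpow_one {A : Matrix ι ι ℂ} (hA : A.PosSemidef) : A ^ (1 : ℝ) = A :=
  CFC.rpow_one A hA.nonneg

theorem sqrt_eq_rpow (A : Matrix ι ι ℂ) :
    CFC.sqrt A = A ^ (1 / 2 : ℝ) :=
  CFC.sqrt_eq_rpow

/-- The orthogonal projection onto the support of a positive matrix. -/
noncomputable def suppProj (A : Matrix ι ι ℂ) : Matrix ι ι ℂ := A ^ (1 : ℝ) * A ^ (-1 : ℝ)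

theorem suppProj_conj_diagonal {U : Matrix ι ι ℂ} (hU : U ∈ unitaryGroup ι ℂ) {d : ι → ℝ}
    (hd : ∀ i, 0 ≤ d i) :
    suppProj (U * diagonal (fun i => (d i : ℂ)) * Uᴴ) =
      U * diagonal (fun i => if d i = 0 then 0 else 1) * Uᴴ := by
  simp only [suppProj, rpow_conj_diagonal hU hd, conj_diagonal_mul hU]
  congr 3
  ext i
  split_ifs with h
  · simp [h]
  · rw [← Complex.ofReal_mul, ← Real.rpow_add (lt_of_le_of_ne (hd i) (Ne.symm h))]
    simp

theorem rpow_mul_rpow_neg {A : Matrix ι ι ℂ} (hA : A.PosSemidef) {s t : ℝ} (hs : s ≠ 0)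
    (hst : s + t = 0) : A ^ s * A ^ t = suppProj A := by
  obtain ⟨U, hU, d, hd, rfl⟩ := exists_diagonalization hA
  rw [suppProj_conj_diagonal hU hd]
  simp only [rpow_conj_diagonal hU hd, conj_diagonal_mul hU]
  congr 3
  ext i
  split_ifs with h
  · simp [h, Real.zero_rpow hs]
  · rw [← Complex.ofReal_mul, ← Real.rpow_add (lt_of_le_of_ne (hd i) (Ne.symm h)), hst]
    simp

theorem suppProj_mul_rpow {A : Matrix ι ι ℂ} (hA : A.PosSemidef) {t : ℝ} (ht : t ≠ 0) :
    suppProj A * A ^ t = A ^ t := by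
  obtain ⟨U, hU, d, hd, rfl⟩ := exists_diagonalization hA
  rw [suppProj_conj_diagonal hU hd]
  simp only [rpow_conj_diagonal hU hd, conj_diagonal_mul hU]
  congr 3
  ext i
  split_ifs with h
  · simp [h, Real.zero_rpow ht]
  · simp

theorem suppProj_mul_self {A : Matrix ι ι ℂ} (hA : A.PosSemidef) : suppProj A * A = A := by
  have := suppProj_mul_rpow hA one_ne_zero
  rwa [rpow_one hA] at this

theorem conjTranspose_suppProj {A : Matrix ι ι ℂ} (hA : A.PosSemidef) :
    (suppProj A)ᴴ = suppProj A := by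
  rw [suppProj, conjTranspose_mul, conjTranspose_rpow, conjTranspose_rpow,
    rpow_mul_rpow_neg hA (by norm_num) (by norm_num), suppProj]

theorem suppProj_mul_suppProj {A : Matrix ι ι ℂ} (hA : A.PosSemidef) :
    suppProj A * suppProj A = suppProj A := by
  change suppProj A * (A ^ (1 : ℝ) * A ^ (-1 : ℝ)) = _
  rw [← Matrix.mul_assoc, suppProj_mul_rpow hA one_ne_zero]
  rfl

/-- Turns the support condition into an algebraic identity, the only form in which it is used below.
-/
theorem supp_le_supp_iff {A B : Matrix ι ι ℂ} (hB : B.PosSemidef) :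
    supp A ≤ supp B ↔ suppProj B * A = A := by
  constructor
  · intro h
    refine Matrix.ext_of_mulVec_single fun i => ?_
    obtain ⟨w, hw⟩ := h ⟨Pi.single i 1, rfl⟩
    simp only [mulVecLin_apply] at hw
    rw [← mulVec_mulVec, ← hw, mulVec_mulVec, suppProj_mul_self hB]
  · rintro h _ ⟨v, rfl⟩
    refine ⟨B ^ (-1 : ℝ) *ᵥ (A *ᵥ v), ?_⟩
    simp only [mulVecLin_apply]
    conv_rhs => rw [← h]
    simp only [mulVec_mulVec, suppProj, rpow_one hB, Matrix.mul_assoc]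

theorem kronecker_mem_unitaryGroup {U : Matrix ι ι ℂ} {V : Matrix κ κ ℂ}
    (hU : U ∈ unitaryGroup ι ℂ) (hV : V ∈ unitaryGroup κ ℂ) :
    U ⊗ₖ V ∈ unitaryGroup (ι × κ) ℂ := by
  rw [mem_unitaryGroup_iff, star_eq_conjTranspose, conjTranspose_kronecker, ← mul_kronecker_mul,
    ← star_eq_conjTranspose, ← star_eq_conjTranspose, mem_unitaryGroup_iff.1 hU,
    mem_unitaryGroup_iff.1 hV, one_kronecker_one]

theorem kronecker_rpow {A : Matrix ι ι ℂ} {B : Matrix κ κ ℂ} (hA : A.PosSemidef)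
    (hB : B.PosSemidef) (t : ℝ) : (A ⊗ₖ B) ^ t = (A ^ t) ⊗ₖ (B ^ t) := by
  obtain ⟨U, hU, d, hd, rfl⟩ := exists_diagonalization hA
  obtain ⟨V, hV, e, he, rfl⟩ := exists_diagonalization hB
  have key : ∀ (d : ι → ℝ) (e : κ → ℝ),
      (U * diagonal (fun i => (d i : ℂ)) * Uᴴ) ⊗ₖ (V * diagonal (fun i => (e i : ℂ)) * Vᴴ) =
      (U ⊗ₖ V) * diagonal (fun p : ι × κ => ((d p.1 * e p.2 : ℝ) : ℂ)) * (U ⊗ₖ V)ᴴ := by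
    intro d e
    rw [mul_kronecker_mul, mul_kronecker_mul, diagonal_kronecker_diagonal, conjTranspose_kronecker]
    simp
  rw [rpow_conj_diagonal hU hd, rpow_conj_diagonal hV he, key, key,
    rpow_conj_diagonal (d := fun p : ι × κ => d p.1 * e p.2) (kronecker_mem_unitaryGroup hU hV)
      (fun p => mul_nonneg (hd _) (he _))]
  congr 3
  ext p
  rw [Real.mul_rpow (hd _) (he _)]

theorem suppProj_kronecker {A : Matrix ι ι ℂ} {B : Matrix κ κ ℂ} (hA : A.PosSemidef)
    (hB : B.PosSemidef) : suppProj (A ⊗ₖ B) = suppProj A ⊗ₖ suppProj B := by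
  simp only [suppProj, kronecker_rpow hA hB, mul_kronecker_mul]

end Powers

/-! ### Hilbert–Schmidt Cauchy–Schwarz and the trace norm -/

section TraceInequalities

variable {ι : Type*} [Fintype ι]

theorem trace_conjTranspose_mul_self_re (A : Matrix ι ι ℂ) :
    (Aᴴ * A).trace.re = ∑ p : ι × ι, ‖A p.1 p.2‖ ^ 2 := by
  rw [Fintype.sum_prod_type_right]
  simp [trace, mul_apply, ← Complex.normSq_eq_norm_sq, Complex.normSq_apply]

theorem trace_conjTranspose_mul_self_nonneg (A : Matrix ι ι ℂ) : 0 ≤ (Aᴴ * A).trace.re := by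
  rw [trace_conjTranspose_mul_self_re]; positivity

/-- Cauchy–Schwarz for the Hilbert–Schmidt inner product. -/
theorem trace_conjTranspose_mul_re_sq_le (A B : Matrix ι ι ℂ) :
    (Aᴴ * B).trace.re ^ 2 ≤ (Aᴴ * A).trace.re * (Bᴴ * B).trace.re := by
  have h : |(Aᴴ * B).trace.re| ≤ ∑ p : ι × ι, ‖A p.1 p.2‖ * ‖B p.1 p.2‖ := by
    refine (Complex.abs_re_le_norm _).trans ?_
    rw [Fintype.sum_prod_type_right]
    simp only [trace, diag_apply, mul_apply, conjTranspose_apply]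
    refine (norm_sum_le _ _).trans (Finset.sum_le_sum fun i _ => (norm_sum_le _ _).trans ?_)
    simp
  rw [trace_conjTranspose_mul_self_re, trace_conjTranspose_mul_self_re, ← sq_abs]
  exact (pow_le_pow_left₀ (abs_nonneg _) h 2).trans (Finset.sum_mul_sq_le_sq_mul_sq _ _ _)

variable [DecidableEq ι]

/-- In an eigenbasis of `Mᴴ M` the columns of `M` have the singular values as norms, and each
diagonal entry is at most the norm of its column. -/
theorem trace_re_le_traceNorm (M : Matrix ι ι ℂ) : M.trace.re ≤ traceNorm M := by
  have hpos : (Mᴴ * M).PosSemidef := posSemidef_conjTranspose_mul_self M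
  obtain ⟨U, hU, d, hd, hM⟩ := exists_diagonalization hpos
  have hUU : Uᴴ * U = 1 := mem_unitaryGroup_iff'.1 hU
  have hUU' : U * Uᴴ = 1 := mem_unitaryGroup_iff.1 hU
  have htr : ∀ e : ι → ℂ, (U * diagonal e * Uᴴ).trace = ∑ i, e i := fun e => by
    rw [trace_mul_comm, ← Matrix.mul_assoc, hUU, Matrix.one_mul, trace_diagonal]
  have hN : (Uᴴ * M * U)ᴴ * (Uᴴ * M * U) = diagonal (fun i => (d i : ℂ)) := by
    calc (Uᴴ * M * U)ᴴ * (Uᴴ * M * U) = Uᴴ * (Mᴴ * (U * Uᴴ) * M) * U := by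
          simp only [conjTranspose_mul, conjTranspose_conjTranspose, Matrix.mul_assoc]
      _ = (Uᴴ * U) * diagonal (fun i => (d i : ℂ)) * (Uᴴ * U) := by
          rw [hUU', Matrix.mul_one, hM]; simp only [Matrix.mul_assoc]
      _ = _ := by rw [hUU, Matrix.one_mul, Matrix.mul_one]
  rw [traceNorm, sqrt_eq_rpow, hM, rpow_conj_diagonal hU hd, htr]
  have h1 : M.trace = (Uᴴ * M * U).trace := by
    rw [Matrix.mul_assoc, trace_mul_comm, Matrix.mul_assoc, hUU', Matrix.mul_one]
  rw [h1, trace, Complex.re_sum, Complex.re_sum]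
  refine Finset.sum_le_sum fun i _ => ?_
  rw [Complex.ofReal_re, ← Real.sqrt_eq_rpow]
  refine Real.le_sqrt_of_sq_le ?_
  have h2 : d i = ∑ k, ‖(Uᴴ * M * U) k i‖ ^ 2 := by
    have := congrArg Complex.re (congrFun (congrFun hN i) i)
    rw [diagonal_apply_eq, Complex.ofReal_re] at this
    rw [← this, mul_apply, Complex.re_sum]
    refine Finset.sum_congr rfl fun k _ => ?_
    rw [conjTranspose_apply, ← Complex.normSq_eq_norm_sq, Complex.normSq_apply]
    simp
  rw [h2]
  refine le_trans ?_ (Finset.single_le_sum (f := fun k => ‖(Uᴴ * M * U) k i‖ ^ 2)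
    (fun k _ => by positivity) (Finset.mem_univ i))
  rw [diag_apply, ← sq_abs]
  exact pow_le_pow_left₀ (abs_nonneg _) (Complex.abs_re_le_norm _) 2

end TraceInequalities

/-! ### Trace inequalities between powers of two states -/

section Densities

variable {ι : Type*} [Fintype ι] [DecidableEq ι]

/-- Evaluates the squared Hilbert–Schmidt norms that arise in each Cauchy–Schwarz step. -/
theorem trace_rpow_mul_rpow_eq {α β : Matrix ι ι ℂ} (hα : α.PosSemidef) (hβ : β.PosSemidef)
    {s t s' t' : ℝ} (hs : s + s = s') (ht : t + t = t') (hs' : s' ≠ 0) (ht' : t' ≠ 0) :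
    ((α ^ s * β ^ t)ᴴ * (α ^ s * β ^ t)).trace = (α ^ s' * β ^ t').trace := by
  rw [conjTranspose_mul, conjTranspose_rpow, conjTranspose_rpow, Matrix.mul_assoc, trace_mul_comm,
    ← rpow_mul_rpow hα hs hs', ← rpow_mul_rpow hβ ht ht']
  simp only [Matrix.mul_assoc]

theorem trace_rpow_mul_rpow_nonneg {α β : Matrix ι ι ℂ} (hα : α.PosSemidef) (hβ : β.PosSemidef)
    {s t : ℝ} (hs : s ≠ 0) (ht : t ≠ 0) : 0 ≤ (α ^ s * β ^ t).trace.re := by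
  rw [← trace_rpow_mul_rpow_eq hα hβ (add_halves s) (add_halves t) hs ht]
  exact trace_conjTranspose_mul_self_nonneg _

theorem trace_half_mul_half_le_one {α β : Matrix ι ι ℂ} (hα : IsDensity α) (hβ : IsDensity β) :
    (α ^ (1 / 2 : ℝ) * β ^ (1 / 2 : ℝ)).trace.re ≤ 1 := by
  have h := trace_conjTranspose_mul_re_sq_le (α ^ (1 / 2 : ℝ)) (β ^ (1 / 2 : ℝ))
  rw [conjTranspose_rpow, conjTranspose_rpow, rpow_mul_rpow hα.1 (add_halves 1) one_ne_zero,
    rpow_mul_rpow hβ.1 (add_halves 1) one_ne_zero, rpow_one hα.1, rpow_one hβ.1, hα.2, hβ.2] at h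
  rw [Complex.one_re, one_mul] at h
  exact (abs_le.1 ((sq_le_one_iff_abs_le_one _).1 h)).2

/-- The Petz quasi-entropy of order `5/4` is at least one. -/
theorem one_le_trace_rpow_five_quarters {α β : Matrix ι ι ℂ} (hα : IsDensity α)
    (hβ : IsDensity β) (h : suppProj β * α = α) :
    1 ≤ (α ^ (5 / 4 : ℝ) * β ^ (-1 / 4 : ℝ)).trace.re := by
  have h1 := trace_half_mul_half_le_one hα hβ
  -- As `α^{1/2}` has unit norm, this gives `Tr(α^{3/4} β^{1/4})² ≤ Tr(α^{1/2} β^{1/2}) ≤ 1`.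
  have h2 := trace_conjTranspose_mul_re_sq_le (α ^ (1 / 2 : ℝ)) (α ^ (1 / 4 : ℝ) * β ^ (1 / 4 : ℝ))
  rw [trace_rpow_mul_rpow_eq (s' := 1 / 2) (t' := 1 / 2) hα.1 hβ.1 (by norm_num) (by norm_num)
    (by norm_num) (by norm_num), conjTranspose_rpow, rpow_mul_rpow hα.1 (add_halves 1) one_ne_zero,
    rpow_one hα.1, hα.2, ← Matrix.mul_assoc,
    rpow_mul_rpow (u := 3 / 4) hα.1 (by norm_num) (by norm_num), Complex.one_re, one_mul] at h2
  -- The exponents make the inner product `Tr α = 1`, so `1 ≤ Tr(α^{3/4} β^{1/4}) · Tr(α^{5/4}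
  -- β^{-1/4})`, with first factor at most one.
  have h3 := trace_conjTranspose_mul_re_sq_le ((α ^ (3 / 8 : ℝ) * β ^ (1 / 8 : ℝ)))
    (α ^ (5 / 8 : ℝ) * β ^ (-1 / 8 : ℝ))
  rw [trace_rpow_mul_rpow_eq (s' := 3 / 4) (t' := 1 / 4) hα.1 hβ.1 (by norm_num) (by norm_num)
    (by norm_num) (by norm_num), trace_rpow_mul_rpow_eq (s' := 5 / 4) (t' := -1 / 4) hα.1 hβ.1
    (by norm_num) (by norm_num) (by norm_num) (by norm_num), conjTranspose_mul,
    conjTranspose_rpow, conjTranspose_rpow] at h3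
  have h4 : (β ^ (1 / 8 : ℝ) * α ^ (3 / 8 : ℝ) * (α ^ (5 / 8 : ℝ) *
      β ^ (-1 / 8 : ℝ))).trace = 1 := by
    rw [← Matrix.mul_assoc, trace_mul_comm, ← Matrix.mul_assoc, ← Matrix.mul_assoc,
      rpow_mul_rpow_neg hβ.1 (by norm_num) (by norm_num), Matrix.mul_assoc,
      rpow_mul_rpow (u := 1) hα.1 (by norm_num) (by norm_num), rpow_one hα.1, h, hα.2]
  rw [h4, Complex.one_re, one_pow] at h3
  have h5 := trace_rpow_mul_rpow_nonneg (s := 5 / 4) (t := -1 / 4) hα.1 hβ.1 (by norm_num)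
    (by norm_num)
  have h6 : (α ^ (3 / 4 : ℝ) * β ^ (1 / 4 : ℝ)).trace.re ≤ 1 :=
    (abs_le.1 ((sq_le_one_iff_abs_le_one _).1 (h2.trans h1))).2
  nlinarith

/-- `Tr(α^{3/2} β^{-1/2})² ≤ Tr(β^{-1/2} α β^{-1/2} α)`. -/
theorem trace_three_halves_sq_le {α : Matrix ι ι ℂ} (hα : IsDensity α) (β : Matrix ι ι ℂ) :
    (α ^ (3 / 2 : ℝ) * β ^ (-1 / 2 : ℝ)).trace.re ^ 2 ≤
      (β ^ (-1 / 2 : ℝ) * α * β ^ (-1 / 2 : ℝ) * α).trace.re := by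
  -- The unit vector `α^{1/2}` is paired with `α^{1/2} β^{-1/2} α^{1/2}`, whose squared norm is the
  -- collision quantity.
  have h := trace_conjTranspose_mul_re_sq_le (α ^ (1 / 2 : ℝ))
    (α ^ (1 / 2 : ℝ) * β ^ (-1 / 2 : ℝ) * α ^ (1 / 2 : ℝ))
  have hh : α ^ (1 / 2 : ℝ) * α ^ (1 / 2 : ℝ) = α := by
    rw [rpow_mul_rpow hα.1 (add_halves 1) one_ne_zero, rpow_one hα.1]
  simp only [conjTranspose_mul, conjTranspose_rpow] at h
  rw [hh, hα.2, Complex.one_re, one_mul] at h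
  have e1 : (α ^ (1 / 2 : ℝ) * (α ^ (1 / 2 : ℝ) * β ^ (-1 / 2 : ℝ) * α ^ (1 / 2 : ℝ))).trace =
      (α ^ (3 / 2 : ℝ) * β ^ (-1 / 2 : ℝ)).trace := by
    rw [← Matrix.mul_assoc, trace_mul_comm, ← Matrix.mul_assoc, ← Matrix.mul_assoc, hh]
    nth_rewrite 1 [← rpow_one hα.1]
    rw [rpow_mul_rpow (u := 3 / 2) hα.1 (by norm_num) (by norm_num)]
  have e2 : (α ^ (1 / 2 : ℝ) * (β ^ (-1 / 2 : ℝ) * α ^ (1 / 2 : ℝ)) *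
      (α ^ (1 / 2 : ℝ) * β ^ (-1 / 2 : ℝ) * α ^ (1 / 2 : ℝ))).trace =
      (β ^ (-1 / 2 : ℝ) * α * β ^ (-1 / 2 : ℝ) * α).trace := by
    rw [Matrix.mul_assoc, trace_mul_comm]
    calc _ = (β ^ (-1 / 2 : ℝ) * (α ^ (1 / 2 : ℝ) * α ^ (1 / 2 : ℝ)) * β ^ (-1 / 2 : ℝ) *
          (α ^ (1 / 2 : ℝ) * α ^ (1 / 2 : ℝ))).trace := by simp only [Matrix.mul_assoc]
      _ = _ := by rw [hh]
  rwa [e1, e2] at h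

end Densities

/-! ### Marginals and the central overlap inequality -/

section Marginals

variable {r b : Type*} [Fintype r] [DecidableEq r] [Fintype b] [DecidableEq b]

theorem trace_mul_kronecker_one (X : Matrix (r × b) (r × b) ℂ) (B : Matrix r r ℂ) :
    (X * (B ⊗ₖ (1 : Matrix b b ℂ))).trace = (marginal X * B).trace := by
  simp only [trace, diag_apply, mul_apply, Fintype.sum_prod_type, kronecker_apply, marginal,
    of_apply, Finset.sum_mul, one_apply, mul_ite, mul_one, mul_zero, Finset.sum_ite_eq',
    Finset.mem_univ, if_true]
  exact Finset.sum_congr rfl fun i _ => Finset.sum_comm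

theorem trace_marginal (X : Matrix (r × b) (r × b) ℂ) : (marginal X).trace = X.trace := by
  simpa using (trace_mul_kronecker_one X 1).symm

theorem marginal_posSemidef {X : Matrix (r × b) (r × b) ℂ} (hX : X.PosSemidef) :
    (marginal X).PosSemidef := by
  have : marginal X = ∑ k, X.submatrix (fun i => (i, k)) (fun i => (i, k)) := by
    ext i j
    simp [marginal, Matrix.sum_apply]
  rw [this]
  exact posSemidef_sum _ fun k _ => hX.submatrix _

theorem IsDensity.marginal {X : Matrix (r × b) (r × b) ℂ} (hX : IsDensity X) :
    IsDensity (marginal X) :=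
  ⟨marginal_posSemidef hX.1, by rw [trace_marginal, hX.2]⟩

theorem marginal_kronecker_one_mul (B : Matrix r r ℂ) (X : Matrix (r × b) (r × b) ℂ) :
    ConvexSplit.marginal ((B ⊗ₖ (1 : Matrix b b ℂ)) * X) = B * ConvexSplit.marginal X := by
  ext i j
  simp only [ConvexSplit.marginal, of_apply, mul_apply, Fintype.sum_prod_type, kronecker_apply,
    one_apply, mul_ite, mul_one, mul_zero, ite_mul, zero_mul, Finset.sum_ite_eq, Finset.mem_univ,
    if_true, Finset.mul_sum]
  exact Finset.sum_comm

theorem IsDensity.kronecker {ω : Matrix r r ℂ} {s : Matrix b b ℂ} (hω : IsDensity ω)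
    (hs : IsDensity s) : IsDensity (ω ⊗ₖ s) :=
  ⟨hω.1.kronecker hs.1, by rw [trace_kronecker, hω.2, hs.2, one_mul]⟩

/-- The support projection of `ω ⊗ s` is a product of projections, so it absorbs either factor
separately. -/
theorem one_kronecker_suppProj_mul {α : Matrix (r × b) (r × b) ℂ} {ω : Matrix r r ℂ}
    {s : Matrix b b ℂ} (hω : ω.PosSemidef) (hs : s.PosSemidef) (h : suppProj (ω ⊗ₖ s) * α = α) :
    ((1 : Matrix r r ℂ) ⊗ₖ suppProj s) * α = α := by
  conv_lhs => rw [← h]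
  rw [← Matrix.mul_assoc, suppProj_kronecker hω hs, ← mul_kronecker_mul, Matrix.one_mul,
    suppProj_mul_suppProj hs, ← suppProj_kronecker hω hs, h]

theorem kronecker_one_suppProj_mul {α : Matrix (r × b) (r × b) ℂ} {ω : Matrix r r ℂ}
    {s : Matrix b b ℂ} (hω : ω.PosSemidef) (hs : s.PosSemidef) (h : suppProj (ω ⊗ₖ s) * α = α) :
    (suppProj ω ⊗ₖ (1 : Matrix b b ℂ)) * α = α := by
  conv_lhs => rw [← h]
  rw [← Matrix.mul_assoc, suppProj_kronecker hω hs, ← mul_kronecker_mul, Matrix.one_mul,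
    suppProj_mul_suppProj hω, ← suppProj_kronecker hω hs, h]

theorem suppProj_mul_marginal {α : Matrix (r × b) (r × b) ℂ} {ω : Matrix r r ℂ}
    {s : Matrix b b ℂ} (hω : ω.PosSemidef) (hs : s.PosSemidef) (h : suppProj (ω ⊗ₖ s) * α = α) :
    suppProj ω * ConvexSplit.marginal α = ConvexSplit.marginal α := by
  rw [← marginal_kronecker_one_mul, kronecker_one_suppProj_mul hω hs h]

/-- The overlap of a state with the product of its own marginal and `s` is controlled by the
collision quantity relative to `ω ⊗ s`, for any state `ω` of the first system. -/
theorem one_le_overlap_mul_collision {α : Matrix (r × b) (r × b) ℂ} {ω : Matrix r r ℂ}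
    {s : Matrix b b ℂ} (hα : IsDensity α) (hω : IsDensity ω) (hs : IsDensity s)
    (h : suppProj (ω ⊗ₖ s) * α = α) :
    1 ≤ (α ^ (1 / 2 : ℝ) * (ConvexSplit.marginal α ⊗ₖ s) ^ (1 / 2 : ℝ)).trace.re ^ 2 *
      ((ω ⊗ₖ s) ^ (-1 / 2 : ℝ) * α * (ω ⊗ₖ s) ^ (-1 / 2 : ℝ) * α).trace.re := by
  set m := ConvexSplit.marginal α with hm
  have hmd : IsDensity m := hα.marginal
  have hms := hmd.kronecker hs
  have hωs := hω.kronecker hs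
  have h1 := one_le_trace_rpow_five_quarters hmd hω (suppProj_mul_marginal hω.1 hs.1 h)
  -- The powers `1/4` and `3/4` recombine to `α` in the inner product, while the squared norms are
  -- `G` and `T` below.
  have h2 := trace_conjTranspose_mul_re_sq_le (α ^ (1 / 4 : ℝ) * (m ⊗ₖ s) ^ (1 / 4 : ℝ))
    (α ^ (3 / 4 : ℝ) * (ω ⊗ₖ s) ^ (-1 / 4 : ℝ))
  rw [trace_rpow_mul_rpow_eq (s' := 1 / 2) (t' := 1 / 2) hα.1 hms.1 (by norm_num) (by norm_num)
    (by norm_num) (by norm_num), trace_rpow_mul_rpow_eq (s' := 3 / 2) (t' := -1 / 2) hα.1 hωs.1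
    (by norm_num) (by norm_num) (by norm_num) (by norm_num), conjTranspose_mul,
    conjTranspose_rpow, conjTranspose_rpow] at h2
  have h3 : ((m ⊗ₖ s) ^ (1 / 4 : ℝ) * α ^ (1 / 4 : ℝ) *
      (α ^ (3 / 4 : ℝ) * (ω ⊗ₖ s) ^ (-1 / 4 : ℝ))).trace =
      (m ^ (5 / 4 : ℝ) * ω ^ (-1 / 4 : ℝ)).trace := by
    calc _ = (α * ((ω ⊗ₖ s) ^ (-1 / 4 : ℝ) * (m ⊗ₖ s) ^ (1 / 4 : ℝ))).trace := by
          rw [Matrix.mul_assoc, trace_mul_comm, ← Matrix.mul_assoc (α ^ (1 / 4 : ℝ)),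
            rpow_mul_rpow (u := 1) hα.1 (by norm_num) (by norm_num), rpow_one hα.1,
            Matrix.mul_assoc]
      -- The powers `±1/4` of `s` cancel to its support projection, which `α` absorbs; what is left
      -- acts on the first system only and sees just the marginal.
      _ = (α * (((ω ^ (-1 / 4 : ℝ) * m ^ (1 / 4 : ℝ)) ⊗ₖ (1 : Matrix b b ℂ)) *
            ((1 : Matrix r r ℂ) ⊗ₖ suppProj s))).trace := by
          rw [kronecker_rpow hω.1 hs.1, kronecker_rpow hmd.1 hs.1, ← mul_kronecker_mul,
            rpow_mul_rpow_neg hs.1 (by norm_num) (by norm_num), ← mul_kronecker_mul,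
            Matrix.mul_one, Matrix.one_mul]
      _ = (m * (ω ^ (-1 / 4 : ℝ) * m ^ (1 / 4 : ℝ))).trace := by
          rw [← Matrix.mul_assoc, trace_mul_comm, ← Matrix.mul_assoc,
            one_kronecker_suppProj_mul hω.1 hs.1 h, trace_mul_kronecker_one]
      _ = _ := by
          rw [← Matrix.mul_assoc, trace_mul_comm, ← Matrix.mul_assoc]
          nth_rewrite 2 [← rpow_one hmd.1]
          rw [rpow_mul_rpow (u := 5 / 4) hmd.1 (by norm_num) (by norm_num)]
  rw [h3] at h2
  have h4 := trace_three_halves_sq_le hα (ω ⊗ₖ s)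
  set G := (α ^ (1 / 2 : ℝ) * (m ⊗ₖ s) ^ (1 / 2 : ℝ)).trace.re
  set T := (α ^ (3 / 2 : ℝ) * (ω ⊗ₖ s) ^ (-1 / 2 : ℝ)).trace.re
  have h5 : 1 ≤ G * T := le_trans (by nlinarith) h2
  calc (1 : ℝ) ≤ (G * T) ^ 2 := one_le_pow₀ h5
    _ = G ^ 2 * T ^ 2 := by ring
    _ ≤ _ := by gcongr

end Marginals

/-! ### Tensor powers -/

section Tensor

variable {κ a : Type*} [Fintype κ] [DecidableEq κ] [Fintype a] [DecidableEq a]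

/-- The tensor product of a finite family of matrices. -/
def tensor (v : κ → Matrix a a ℂ) : Matrix (κ → a) (κ → a) ℂ :=
  Matrix.of fun f g => ∏ y, v y (f y) (g y)

theorem tensorPow_eq_tensor (n : ℕ) (σ : Matrix a a ℂ) : tensorPow n σ = tensor fun _ => σ := rfl

theorem tensor_mul_tensor (v w : κ → Matrix a a ℂ) :
    tensor v * tensor w = tensor fun y => v y * w y := by
  ext f g
  simp only [tensor, mul_apply, of_apply, ← Finset.prod_mul_distrib]
  rw [Finset.prod_univ_sum, Fintype.piFinset_univ]

theorem trace_tensor (v : κ → Matrix a a ℂ) : (tensor v).trace = ∏ y, (v y).trace := by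
  simp only [tensor, trace, diag_apply, of_apply]
  rw [Finset.prod_univ_sum, Fintype.piFinset_univ]

theorem tensor_diagonal (d : κ → a → ℂ) :
    tensor (fun y => diagonal (d y)) = diagonal fun f : κ → a => ∏ y, d y (f y) := by
  ext f g
  by_cases h : f = g
  · subst h; simp [tensor]
  · rw [diagonal_apply_ne _ h]
    obtain ⟨y, hy⟩ := Function.ne_iff.1 h
    exact Finset.prod_eq_zero (Finset.mem_univ y) (diagonal_apply_ne _ hy)

theorem conjTranspose_tensor (v : κ → Matrix a a ℂ) : (tensor v)ᴴ = tensor fun y => (v y)ᴴ := by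
  ext f g
  simp [tensor]

theorem tensorPow_rpow (n : ℕ) {σ : Matrix a a ℂ} (hσ : σ.PosSemidef) (t : ℝ) :
    tensorPow n σ ^ t = tensorPow n (σ ^ t) := by
  obtain ⟨U, hU, d, hd, rfl⟩ := exists_diagonalization hσ
  have key : ∀ d : a → ℝ, tensorPow n (U * diagonal (fun i => (d i : ℂ)) * Uᴴ) =
      tensorPow n U * diagonal (fun f : Fin n → a => ((∏ y, d (f y) : ℝ) : ℂ)) *
        (tensorPow n U)ᴴ := by
    intro d
    simp only [Complex.ofReal_prod]
    rw [← tensor_diagonal (fun (_ : Fin n) i => (d i : ℂ))]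
    simp only [tensorPow_eq_tensor, conjTranspose_tensor, tensor_mul_tensor]
  have hUn : tensorPow n U ∈ unitaryGroup (Fin n → a) ℂ := by
    rw [mem_unitaryGroup_iff, star_eq_conjTranspose, tensorPow_eq_tensor, conjTranspose_tensor,
      tensor_mul_tensor, ← star_eq_conjTranspose, mem_unitaryGroup_iff.1 hU]
    simpa using tensor_diagonal (κ := Fin n) fun _ (_ : a) => 1
  rw [rpow_conj_diagonal hU hd, key, key,
    rpow_conj_diagonal hUn fun f => Finset.prod_nonneg fun y _ => hd _]
  congr 3
  ext f
  rw [Real.finsetProd_rpow _ _ fun y _ => hd _]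

theorem suppProj_tensorPow (n : ℕ) {σ : Matrix a a ℂ} (hσ : σ.PosSemidef) :
    suppProj (tensorPow n σ) = tensorPow n (suppProj σ) := by
  rw [suppProj, tensorPow_rpow n hσ, tensorPow_rpow n hσ, tensorPow_eq_tensor,
    tensorPow_eq_tensor, tensor_mul_tensor]
  rfl

/-- Iterated Schur product theorem. Tensor powers and `tauAt` are entrywise products of positive
matrices pulled back along coordinate maps. -/
theorem posSemidef_prod_hadamard {ι : Type*} [Finite ι] (s : Finset κ) (M : κ → Matrix ι ι ℂ)
    (hM : ∀ y ∈ s, (M y).PosSemidef) :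
    (Matrix.of fun p q => ∏ y ∈ s, M y p q).PosSemidef := by
  induction s using Finset.induction_on with
  | empty =>
    -- The empty entrywise product is the all-ones matrix, of rank one.
    simpa [vecMulVec] using! posSemidef_vecMulVec_self_star (fun _ : ι => (1 : ℂ))
  | insert y s hy ih =>
    have := (hM y (Finset.mem_insert_self _ _)).hadamard
      (ih fun z hz => hM z (Finset.mem_insert_of_mem hz))
    have e : (Matrix.of fun p q => ∏ z ∈ insert y s, M z p q) =
        M y ⊙ Matrix.of fun p q => ∏ z ∈ s, M z p q := by
      ext p q
      simp [Finset.prod_insert hy]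
    rw [e]
    exact this

theorem IsDensity.tensorPow (n : ℕ) {σ : Matrix a a ℂ} (hσ : IsDensity σ) :
    IsDensity (tensorPow n σ) :=
  ⟨posSemidef_prod_hadamard Finset.univ
    (fun y => σ.submatrix (fun f : Fin n → a => f y) fun f => f y) fun _ _ => hσ.1.submatrix _,
    by rw [tensorPow_eq_tensor, trace_tensor, hσ.2, Finset.prod_const_one]⟩

end Tensor

/-! ### Block decomposition over the first system -/

section Blocks

variable {r b : Type*} [Fintype r] [DecidableEq r] [Fintype b] [DecidableEq b]

/-- The `(i, j)` block of a matrix on a product space. -/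
def block (X : Matrix (r × b) (r × b) ℂ) (i j : r) : Matrix b b ℂ :=
  Matrix.of fun k l => X (i, k) (j, l)

theorem block_ext {X Y : Matrix (r × b) (r × b) ℂ} (h : ∀ i j, block X i j = block Y i j) :
    X = Y := by
  ext ⟨i, k⟩ ⟨j, l⟩
  exact congrFun (congrFun (h i j) k) l

theorem block_mul (X Y : Matrix (r × b) (r × b) ℂ) (i j : r) :
    block (X * Y) i j = ∑ k, block X i k * block Y k j := by
  ext k l
  simp [block, mul_apply, Matrix.sum_apply, Fintype.sum_prod_type]

theorem block_kronecker (A : Matrix r r ℂ) (B : Matrix b b ℂ) (i j : r) :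
    block (A ⊗ₖ B) i j = A i j • B := by
  ext k l
  simp [block]

theorem trace_eq_sum_block (X : Matrix (r × b) (r × b) ℂ) :
    X.trace = ∑ i, (block X i i).trace := by
  simp [block, trace, Fintype.sum_prod_type]

theorem trace_block (X : Matrix (r × b) (r × b) ℂ) (i j : r) :
    (block X i j).trace = marginal X i j := rfl

/-- Separates the `R`-coefficients from traces on the second system; `trace_mul_mul_mul` has the
same shape, so the collision terms can be compared summand by summand. -/
theorem trace_kronecker_mul_mul (A : Matrix r r ℂ) (B : Matrix b b ℂ)
    (X Y : Matrix (r × b) (r × b) ℂ) :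
    ((A ⊗ₖ B) * X * (A ⊗ₖ B) * Y).trace =
      ∑ i, ∑ j, ∑ l, ∑ k, A i k * A l j * (B * block X k l * B * block Y j i).trace := by
  rw [trace_eq_sum_block]
  simp only [block_mul, block_kronecker, Finset.sum_mul, trace_sum, smul_mul_assoc,
    mul_smul_comm, trace_smul, smul_eq_mul]
  refine Finset.sum_congr rfl fun i _ => Finset.sum_congr rfl fun j _ =>
    Finset.sum_congr rfl fun l _ => ?_
  rw [Finset.mul_sum]
  refine Finset.sum_congr rfl fun k _ => ?_
  ring

theorem trace_mul_mul_mul (A M : Matrix r r ℂ) :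
    (A * M * A * M).trace = ∑ i, ∑ j, ∑ l, ∑ k, A i k * A l j * (M k l * M j i) := by
  simp only [trace, diag_apply, mul_apply, Finset.sum_mul]
  refine Finset.sum_congr rfl fun i _ => Finset.sum_congr rfl fun j _ =>
    Finset.sum_congr rfl fun l _ => Finset.sum_congr rfl fun k _ => ?_
  ring

theorem block_one_kronecker_mul (B : Matrix b b ℂ) (X : Matrix (r × b) (r × b) ℂ) (i j : r) :
    block (((1 : Matrix r r ℂ) ⊗ₖ B) * X) i j = B * block X i j := by
  simp [block_mul, block_kronecker, one_apply, ite_smul]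

end Blocks

/-! ### The convex-split state and its collision quantity -/

section ConvexSplitState

variable {r a : Type*} [Fintype r] [DecidableEq r] [Fintype a] [DecidableEq a] {n : ℕ}
  {ρ : Matrix (r × a) (r × a) ℂ} {σ : Matrix a a ℂ}

/-- With the `R`-indices fixed, `τ_x` becomes an elementary tensor, so traces of products of blocks
factor over the sites. -/
theorem block_tauAt (ρ : Matrix (r × a) (r × a) ℂ) (σ : Matrix a a ℂ) (x : Fin n) (i j : r) :
    block (tauAt n ρ σ x) i j = tensor (Function.update (fun _ => σ) x (block ρ i j)) := by
  ext f g
  simp only [block, tauAt, tensor, of_apply]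
  rw [← Finset.mul_prod_erase Finset.univ _ (Finset.mem_univ x)]
  simp only [Function.update_self, of_apply]
  congr 1
  refine Finset.prod_congr rfl fun y hy => ?_
  rw [Function.update_of_ne (Finset.ne_of_mem_erase hy)]

theorem marginal_tauAt (hσ : σ.trace = 1) (x : Fin n) :
    marginal (tauAt n ρ σ x) = marginal ρ := by
  ext i j
  rw [← trace_block, block_tauAt, trace_tensor, Fintype.prod_eq_single x]
  · rw [Function.update_self, trace_block]
  · intro y hy
    rw [Function.update_of_ne hy, hσ]

theorem marginal_tau (hn : 1 ≤ n) (hσ : σ.trace = 1) : marginal (tau n ρ σ) = marginal ρ := by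
  have h : marginal (tau n ρ σ) = (1 / (n : ℂ)) • ∑ x, marginal (tauAt n ρ σ x) := by
    ext i j
    simp only [marginal, tau, of_apply, Matrix.smul_apply, Matrix.sum_apply, smul_eq_mul,
      ← Finset.mul_sum]
    rw [Finset.sum_comm]
  have hn' : (n : ℂ) ≠ 0 := by exact_mod_cast (by omega : n ≠ 0)
  rw [h]
  simp only [marginal_tauAt hσ, Finset.sum_const, Finset.card_univ, Fintype.card_fin]
  rw [← Nat.cast_smul_eq_nsmul ℂ, smul_smul, one_div, inv_mul_cancel₀ hn', one_smul]

theorem tauAt_posSemidef (hρ : ρ.PosSemidef) (hσ : σ.PosSemidef) (x : Fin n) :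
    (tauAt n ρ σ x).PosSemidef := by
  have h := posSemidef_prod_hadamard (Finset.univ.erase x)
    (fun y => σ.submatrix (fun p : r × (Fin n → a) => p.2 y) fun p => p.2 y)
    fun _ _ => hσ.submatrix _
  exact (hρ.submatrix fun p : r × (Fin n → a) => (p.1, p.2 x)).hadamard h

theorem IsDensity.tau (hn : 1 ≤ n) (hρ : IsDensity ρ) (hσ : IsDensity σ) :
    IsDensity (tau n ρ σ) := by
  refine ⟨?_, by rw [← trace_marginal, marginal_tau hn hσ.2, trace_marginal, hρ.2]⟩
  have h : (∑ x, tauAt n ρ σ x).PosSemidef :=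
    posSemidef_sum _ fun x _ => tauAt_posSemidef hρ.1 hσ.1 x
  refine h.smul ?_
  rw [one_div, ← Complex.ofReal_natCast, ← Complex.ofReal_inv]
  exact_mod_cast inv_nonneg.2 (Nat.cast_nonneg (α := ℝ) n)

theorem kronecker_one_mul_tauAt {P : Matrix r r ℂ}
    (h : (P ⊗ₖ (1 : Matrix a a ℂ)) * ρ = ρ) (x : Fin n) :
    (P ⊗ₖ (1 : Matrix (Fin n → a) (Fin n → a) ℂ)) * tauAt n ρ σ x = tauAt n ρ σ x := by
  ext ⟨i, f⟩ ⟨j, g⟩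
  have := congrFun (congrFun h (i, f x)) (j, g x)
  simp only [mul_apply, Fintype.sum_prod_type, kronecker_apply, one_apply, mul_ite, mul_one,
    mul_zero, ite_mul, zero_mul, Finset.sum_ite_eq, Finset.mem_univ, if_true] at this ⊢
  simp only [tauAt, of_apply, ← mul_assoc, ← Finset.sum_mul, this]

theorem one_kronecker_tensorPow_mul_tauAt {P : Matrix a a ℂ} (hσ : P * σ = σ)
    (h : ((1 : Matrix r r ℂ) ⊗ₖ P) * ρ = ρ) (x : Fin n) :
    ((1 : Matrix r r ℂ) ⊗ₖ tensorPow n P) * tauAt n ρ σ x = tauAt n ρ σ x := by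
  refine block_ext fun i j => ?_
  rw [block_one_kronecker_mul, block_tauAt, tensorPow_eq_tensor, tensor_mul_tensor]
  congr 1
  funext y
  by_cases hy : y = x
  · subst hy
    rw [Function.update_self, ← block_one_kronecker_mul, h]
  · rw [Function.update_of_ne hy, hσ]

theorem suppProj_mul_tau {ω : Matrix r r ℂ} (hω : ω.PosSemidef) (hσ : σ.PosSemidef)
    (hn : (tensorPow n σ).PosSemidef) (h : suppProj (ω ⊗ₖ σ) * ρ = ρ) :
    suppProj (ω ⊗ₖ tensorPow n σ) * tau n ρ σ = tau n ρ σ := by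
  rw [tau, mul_smul_comm, Matrix.mul_sum]
  congr 1
  refine Finset.sum_congr rfl fun x _ => ?_
  have e : suppProj (ω ⊗ₖ tensorPow n σ) = (suppProj ω ⊗ₖ 1) * (1 ⊗ₖ tensorPow n (suppProj σ)) := by
    rw [suppProj_kronecker hω hn, suppProj_tensorPow n hσ, ← mul_kronecker_mul, Matrix.mul_one,
      Matrix.one_mul]
  rw [e, Matrix.mul_assoc, one_kronecker_tensorPow_mul_tauAt (suppProj_mul_self hσ)
    (one_kronecker_suppProj_mul hω hσ h),
    kronecker_one_mul_tauAt (kronecker_one_suppProj_mul hω hσ h)]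

theorem rpow_neg_half_mul_mul (hσ : σ.PosSemidef) :
    σ ^ (-1 / 2 : ℝ) * σ * σ ^ (-1 / 2 : ℝ) = suppProj σ := by
  nth_rewrite 2 [← rpow_one hσ]
  rw [rpow_mul_rpow (u := 1 / 2) hσ (by norm_num) (by norm_num),
    rpow_mul_rpow_neg hσ (by norm_num) (by norm_num)]

/-- Every site other than `x` contributes `Tr(σ^{-1/2} σ σ^{-1/2} σ) = Tr σ = 1`. -/
theorem trace_tauAt_self (hσ : IsDensity σ) (A : Matrix r r ℂ) (x : Fin n) :
    ((A ⊗ₖ tensorPow n (σ ^ (-1 / 2 : ℝ))) * tauAt n ρ σ x *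
      (A ⊗ₖ tensorPow n (σ ^ (-1 / 2 : ℝ))) * tauAt n ρ σ x).trace =
      ((A ⊗ₖ (σ ^ (-1 / 2 : ℝ))) * ρ * (A ⊗ₖ (σ ^ (-1 / 2 : ℝ))) * ρ).trace := by
  rw [trace_kronecker_mul_mul, trace_kronecker_mul_mul]
  refine Finset.sum_congr rfl fun i _ => Finset.sum_congr rfl fun j _ =>
    Finset.sum_congr rfl fun l _ => Finset.sum_congr rfl fun k _ => ?_
  rw [block_tauAt, block_tauAt, tensorPow_eq_tensor, tensor_mul_tensor, tensor_mul_tensor,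
    tensor_mul_tensor, trace_tensor, Fintype.prod_eq_single x]
  · simp only [Function.update_self]
  · intro y hy
    rw [Function.update_of_ne hy, Function.update_of_ne hy, rpow_neg_half_mul_mul hσ.1,
      suppProj_mul_self hσ.1, hσ.2]

theorem trace_tauAt_of_ne (hσ : IsDensity σ) (h : ((1 : Matrix r r ℂ) ⊗ₖ suppProj σ) * ρ = ρ)
    (A : Matrix r r ℂ) {x y : Fin n} (hxy : x ≠ y) :
    ((A ⊗ₖ tensorPow n (σ ^ (-1 / 2 : ℝ))) * tauAt n ρ σ x *
      (A ⊗ₖ tensorPow n (σ ^ (-1 / 2 : ℝ))) * tauAt n ρ σ y).trace =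
      (A * marginal ρ * A * marginal ρ).trace := by
  have hb : ∀ i j, suppProj σ * block ρ i j = block ρ i j := fun i j => by
    rw [← block_one_kronecker_mul, h]
  rw [trace_kronecker_mul_mul, trace_mul_mul_mul]
  refine Finset.sum_congr rfl fun i _ => Finset.sum_congr rfl fun j _ =>
    Finset.sum_congr rfl fun l _ => Finset.sum_congr rfl fun k _ => ?_
  rw [block_tauAt, block_tauAt, tensorPow_eq_tensor, tensor_mul_tensor, tensor_mul_tensor,
    tensor_mul_tensor, trace_tensor, Fintype.prod_eq_mul x y hxy]
  -- At each of the sites `x` and `y` one of the two blocks is `σ`; it cancels both factors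
  -- `σ^{-1/2}`, and the trace of the other block is an entry of the marginal.
  · rw [Function.update_self, Function.update_self, Function.update_of_ne hxy,
      Function.update_of_ne hxy.symm, rpow_neg_half_mul_mul hσ.1, hb, trace_block,
      Matrix.mul_assoc, Matrix.mul_assoc (σ ^ (-1 / 2 : ℝ)), trace_mul_comm,
      Matrix.mul_assoc, trace_mul_comm, rpow_neg_half_mul_mul hσ.1, hb, trace_block]
  · intro z hz
    rw [Function.update_of_ne hz.1, Function.update_of_ne hz.2, rpow_neg_half_mul_mul hσ.1,
      suppProj_mul_self hσ.1, hσ.2]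

theorem trace_tau_collision {ω : Matrix r r ℂ} (hn : 1 ≤ n) (hω : ω.PosSemidef)
    (hσ : IsDensity σ) (h : suppProj (ω ⊗ₖ σ) * ρ = ρ) :
    ((ω ⊗ₖ tensorPow n σ) ^ (-1 / 2 : ℝ) * tau n ρ σ * (ω ⊗ₖ tensorPow n σ) ^ (-1 / 2 : ℝ) *
      tau n ρ σ).trace.re =
      (n - 1) / n * (ω ^ (-1 / 2 : ℝ) * marginal ρ * ω ^ (-1 / 2 : ℝ) * marginal ρ).trace.re +
      1 / n * ((ω ⊗ₖ σ) ^ (-1 / 2 : ℝ) * ρ * (ω ⊗ₖ σ) ^ (-1 / 2 : ℝ) * ρ).trace.re := by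
  have hn' : (n : ℂ) ≠ 0 := by exact_mod_cast (by omega : n ≠ 0)
  rw [kronecker_rpow hω (hσ.tensorPow n).1, tensorPow_rpow n hσ.1, kronecker_rpow hω hσ.1]
  set A := ω ^ (-1 / 2 : ℝ)
  set p := (A * marginal ρ * A * marginal ρ).trace with hp
  set q := ((A ⊗ₖ (σ ^ (-1 / 2 : ℝ))) * ρ * (A ⊗ₖ (σ ^ (-1 / 2 : ℝ))) * ρ).trace with hq
  have key : ((A ⊗ₖ tensorPow n (σ ^ (-1 / 2 : ℝ))) * tau n ρ σ *
      (A ⊗ₖ tensorPow n (σ ^ (-1 / 2 : ℝ))) * tau n ρ σ).trace =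
      (((n - 1) / n : ℝ) : ℂ) * p + ((1 / n : ℝ) : ℂ) * q := by
    -- Writing each term as `p` plus a diagonal correction `q - p` makes the double sum `n² p + n (q
    -- - p)`.
    have hterm : ∀ x y : Fin n, ((A ⊗ₖ tensorPow n (σ ^ (-1 / 2 : ℝ))) * tauAt n ρ σ x *
        (A ⊗ₖ tensorPow n (σ ^ (-1 / 2 : ℝ))) * tauAt n ρ σ y).trace =
        p + if x = y then q - p else 0 := fun x y => by
      split_ifs with hxy
      · subst hxy
        rw [trace_tauAt_self hσ]; ring
      · rw [trace_tauAt_of_ne hσ (one_kronecker_suppProj_mul hω hσ.1 h) A hxy, add_zero]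
    simp only [tau, mul_smul_comm, smul_mul_assoc, Matrix.mul_sum, Matrix.sum_mul, trace_smul,
      trace_sum]
    simp only [hterm, Finset.sum_add_distrib, Finset.sum_const, Finset.card_univ,
      Fintype.card_fin, Finset.sum_ite_eq', Finset.mem_univ, if_true, smul_eq_mul, nsmul_eq_mul]
    push_cast
    field_simp
    ring
  rw [key, Complex.add_re, Complex.re_ofReal_mul, Complex.re_ofReal_mul]

end ConvexSplitState

/-! ### Variational formula and lower semicontinuity of `Q₂` -/

section CollisionEntropy

variable {ι : Type*} [Fintype ι] [DecidableEq ι]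

theorem mul_suppProj_of_suppProj_mul {α β : Matrix ι ι ℂ} (hα : α.PosSemidef)
    (hβ : β.PosSemidef) (h : suppProj β * α = α) : α * suppProj β = α := by
  have := congrArg conjTranspose h
  rwa [conjTranspose_mul, conjTranspose_suppProj hβ, hα.1] at this

theorem trace_sandwich_sq {α β : Matrix ι ι ℂ} (hβ : β.PosSemidef) :
    ((β ^ (-1 / 4 : ℝ) * α * β ^ (-1 / 4 : ℝ)) ^ 2).trace =
      (β ^ (-1 / 2 : ℝ) * α * β ^ (-1 / 2 : ℝ) * α).trace := by
  rw [← rpow_mul_rpow (s := -1 / 4) (t := -1 / 4) (u := -1 / 2) hβ (by norm_num) (by norm_num),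
    pow_two, ← Matrix.mul_assoc (_ * α * _), trace_mul_comm]
  simp only [Matrix.mul_assoc]

theorem conjTranspose_sandwich {α : Matrix ι ι ℂ} (hα : αᴴ = α) (β : Matrix ι ι ℂ) (t : ℝ) :
    (β ^ t * α * β ^ t)ᴴ = β ^ t * α * β ^ t := by
  rw [conjTranspose_mul, conjTranspose_mul, conjTranspose_rpow, hα, Matrix.mul_assoc]

theorem trace_collision_nonneg {α β : Matrix ι ι ℂ} (hα : α.PosSemidef) (hβ : β.PosSemidef) :
    0 ≤ (β ^ (-1 / 2 : ℝ) * α * β ^ (-1 / 2 : ℝ) * α).trace.re := by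
  rw [← trace_sandwich_sq hβ, pow_two]
  have := trace_conjTranspose_mul_self_nonneg (β ^ (-1 / 4 : ℝ) * α * β ^ (-1 / 4 : ℝ))
  rwa [conjTranspose_sandwich hα.1] at this

theorem Q2_of_supported {α β : Matrix ι ι ℂ} (hβ : β.PosSemidef) (h : suppProj β * α = α) :
    Q2 α β = ENNReal.ofReal (β ^ (-1 / 2 : ℝ) * α * β ^ (-1 / 2 : ℝ) * α).trace.re := by
  rw [Q2, if_pos ((supp_le_supp_iff hβ).2 h), trace_sandwich_sq hβ]

theorem Q2_of_not_supported {α β : Matrix ι ι ℂ} (hβ : β.PosSemidef) (h : suppProj β * α ≠ α) :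
    Q2 α β = ⊤ := by
  rw [Q2, if_neg fun h' => h ((supp_le_supp_iff hβ).1 h')]

theorem suppProj_mul_of_Q2_ne_top {α β : Matrix ι ι ℂ} (hβ : β.PosSemidef) (h : Q2 α β ≠ ⊤) :
    suppProj β * α = α := by
  by_contra h'
  exact h (Q2_of_not_supported hβ h')

theorem Q2_self {α : Matrix ι ι ℂ} (hα : IsDensity α) : Q2 α α = 1 := by
  rw [Q2_of_supported hα.1 (suppProj_mul_self hα.1), rpow_neg_half_mul_mul hα.1,
    suppProj_mul_self hα.1, hα.2, Complex.one_re, ENNReal.ofReal_one]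

/-- The concave functional of `H` whose supremum is `Q₂`. -/
noncomputable def collisionDual (α w H : Matrix ι ι ℂ) : ℝ :=
  2 * (α * H).trace.re - (H * w * H * w).trace.re

/-- Completing the square: with `X = β^{-1/4} α β^{-1/4}` and `Y = β^{1/4} H β^{1/4}`, expand `0 ≤
Tr (X - Y)²`. -/
theorem ofReal_collisionDual_le_Q2 {α β H : Matrix ι ι ℂ} (hα : α.PosSemidef)
    (hβ : β.PosSemidef) (hH : Hᴴ = H) :
    ENNReal.ofReal (collisionDual α (β ^ (1 / 2 : ℝ)) H) ≤ Q2 α β := by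
  by_cases h : suppProj β * α = α
  swap
  · rw [Q2_of_not_supported hβ h]; exact le_top
  rw [Q2_of_supported hβ h]
  refine ENNReal.ofReal_le_ofReal ?_
  have hX := conjTranspose_sandwich hα.1 β (-1 / 4)
  have hY := conjTranspose_sandwich hH β (1 / 4)
  have hXX := congrArg Complex.re (trace_sandwich_sq (α := α) hβ)
  have hYY : (β ^ (1 / 4 : ℝ) * H * β ^ (1 / 4 : ℝ) *
      (β ^ (1 / 4 : ℝ) * H * β ^ (1 / 4 : ℝ))).trace =
      (H * β ^ (1 / 2 : ℝ) * H * β ^ (1 / 2 : ℝ)).trace := by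
    rw [← rpow_mul_rpow (s := 1 / 4) (t := 1 / 4) (u := 1 / 2) hβ (by norm_num) (by norm_num),
      Matrix.mul_assoc, Matrix.mul_assoc, trace_mul_comm]
    simp only [Matrix.mul_assoc]
  have hXY : (β ^ (-1 / 4 : ℝ) * α * β ^ (-1 / 4 : ℝ) *
      (β ^ (1 / 4 : ℝ) * H * β ^ (1 / 4 : ℝ))).trace = (α * H).trace := by
    calc _ = (β ^ (1 / 4 : ℝ) * β ^ (-1 / 4 : ℝ) * α * (β ^ (-1 / 4 : ℝ) * β ^ (1 / 4 : ℝ)) *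
          H).trace := by
          rw [← Matrix.mul_assoc, trace_mul_comm]
          simp only [Matrix.mul_assoc]
      _ = _ := by
          rw [rpow_mul_rpow_neg hβ (by norm_num) (by norm_num), h,
            rpow_mul_rpow_neg hβ (by norm_num) (by norm_num),
            mul_suppProj_of_suppProj_mul hα hβ h]
  rw [pow_two] at hXX
  set X := β ^ (-1 / 4 : ℝ) * α * β ^ (-1 / 4 : ℝ)
  set Y := β ^ (1 / 4 : ℝ) * H * β ^ (1 / 4 : ℝ)
  have h0 := trace_conjTranspose_mul_self_nonneg (X - Y)
  rw [conjTranspose_sub, hX, hY, Matrix.sub_mul, Matrix.mul_sub, Matrix.mul_sub, trace_sub,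
    trace_sub, trace_sub, trace_mul_comm Y X, hYY, hXY] at h0
  simp only [Complex.sub_re] at h0
  rw [hXX] at h0
  rw [collisionDual]
  linarith

theorem exists_lt_ofReal_collisionDual {α β : Matrix ι ι ℂ} (hα : α.PosSemidef)
    (hβ : β.PosSemidef) {c : ℝ≥0∞} (hc : c < Q2 α β) :
    ∃ H : Matrix ι ι ℂ, Hᴴ = H ∧ c < ENNReal.ofReal (collisionDual α (β ^ (1 / 2 : ℝ)) H) := by
  by_cases h : suppProj β * α = α
  · rw [Q2_of_supported hβ h] at hc
    -- The maximizer `H = β^{-1/2} α β^{-1/2}` attains `Q₂` exactly.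
    refine ⟨_, conjTranspose_sandwich hα.1 β (-1 / 2), ?_⟩
    have e1 : β ^ (-1 / 2 : ℝ) * α * β ^ (-1 / 2 : ℝ) * β ^ (1 / 2 : ℝ) = β ^ (-1 / 2 : ℝ) * α := by
      rw [Matrix.mul_assoc, rpow_mul_rpow_neg hβ (by norm_num) (by norm_num), Matrix.mul_assoc,
        mul_suppProj_of_suppProj_mul hα hβ h]
    rw [collisionDual, e1, Matrix.mul_assoc _ (β ^ (-1 / 2 : ℝ) * α * _), e1, trace_mul_comm α,
      ← Matrix.mul_assoc, two_mul, add_sub_cancel_right]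
    exact hc
  -- On the kernel of `β` the quadratic term vanishes while `Tr(α K) > 0`, so multiples of `K` make
  -- the functional arbitrarily large; the scaling chosen gives `2(c + 1)`.
  · set K := 1 - suppProj β with hK
    have hKH : Kᴴ = K := by
      rw [hK, conjTranspose_sub, conjTranspose_one, conjTranspose_suppProj hβ]
    have hKK : K * K = K := by
      rw [hK, Matrix.sub_mul, Matrix.one_mul, Matrix.mul_sub, Matrix.mul_one,
        suppProj_mul_suppProj hβ, sub_self, sub_zero]
    have hKβ : K * β ^ (1 / 2 : ℝ) = 0 := by
      rw [hK, Matrix.sub_mul, suppProj_mul_rpow hβ (by norm_num), Matrix.one_mul, sub_self]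
    have hKα : K * α ≠ 0 := fun h0 => h (by
      rw [hK, Matrix.sub_mul, Matrix.one_mul, sub_eq_zero] at h0
      exact h0.symm)
    have hhalf : α ^ (1 / 2 : ℝ) * α ^ (1 / 2 : ℝ) = α := by
      rw [rpow_mul_rpow hα (add_halves 1) one_ne_zero, rpow_one hα]
    have htr : (α * K).trace.re = ((α ^ (1 / 2 : ℝ) * K)ᴴ * (α ^ (1 / 2 : ℝ) * K)).trace.re := by
      rw [conjTranspose_mul, conjTranspose_rpow, hKH, Matrix.mul_assoc, ← Matrix.mul_assoc _ _ K,
        hhalf, trace_mul_comm K, Matrix.mul_assoc, hKK]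
    have hδ : 0 < (α * K).trace.re := by
      rw [htr]
      refine lt_of_le_of_ne (trace_conjTranspose_mul_self_nonneg _) fun h0 => hKα ?_
      rw [trace_conjTranspose_mul_self_re, eq_comm,
        Finset.sum_eq_zero_iff_of_nonneg fun _ _ => by positivity] at h0
      have h1 : α ^ (1 / 2 : ℝ) * K = 0 := by
        ext i j
        simpa using h0 (i, j) (Finset.mem_univ _)
      have h2 : α * K = 0 := by
        rw [← hhalf, Matrix.mul_assoc, h1, Matrix.mul_zero]
      have := congrArg conjTranspose h2
      rwa [conjTranspose_mul, hKH, hα.1, conjTranspose_zero] at this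
    set δ := (α * K).trace.re
    have hc' : c ≠ ⊤ := ne_top_of_lt hc
    refine ⟨(((c.toReal + 1) / δ : ℝ) : ℂ) • K, ?_, ?_⟩
    · rw [conjTranspose_smul, hKH, Complex.star_def, Complex.conj_ofReal]
    · have hval : collisionDual α (β ^ (1 / 2 : ℝ)) ((((c.toReal + 1) / δ : ℝ) : ℂ) • K) =
          2 * (c.toReal + 1) := by
        rw [collisionDual, mul_smul_comm, trace_smul, smul_mul_assoc, hKβ, smul_zero,
          Matrix.zero_mul, Matrix.zero_mul, trace_zero, smul_eq_mul, Complex.re_ofReal_mul]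
        change 2 * ((c.toReal + 1) / δ * δ) - (0 : ℂ).re = _
        rw [div_mul_cancel₀ _ hδ.ne']; simp
      rw [hval, ← ENNReal.ofReal_toReal hc', ENNReal.ofReal_lt_ofReal_iff (by positivity),
        ENNReal.toReal_ofReal (by positivity)]
      have := ENNReal.toReal_nonneg (a := c)
      linarith

/-- For fixed `H` the dual functional is polynomial in `β^{1/2}`. Supplying the square root as a
continuous map `k` avoids any continuity of matrix powers. -/
theorem lowerSemicontinuousOn_Q2 {X : Type*} [TopologicalSpace X] {S : Set X}
    {α : Matrix ι ι ℂ} (hα : α.PosSemidef) {f k : X → Matrix ι ι ℂ}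
    (hf : ∀ x ∈ S, (f x).PosSemidef) (hfk : ∀ x ∈ S, f x ^ (1 / 2 : ℝ) = k x)
    (hk : Continuous k) : LowerSemicontinuousOn (fun x => Q2 α (f x)) S := by
  intro x hx c hc
  obtain ⟨H, hH, hcH⟩ := exists_lt_ofReal_collisionDual hα (hf x hx) hc
  rw [hfk x hx] at hcH
  have hcont : Continuous fun y => ENNReal.ofReal (collisionDual α (k y) H) := by
    unfold collisionDual
    refine ENNReal.continuous_ofReal.comp (continuous_const.sub (Complex.continuous_re.comp ?_))
    exact Continuous.matrix_trace (((continuous_const.matrix_mul hk).matrix_mul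
      continuous_const).matrix_mul hk)
  have hev := hcont.continuousAt.eventually (lt_mem_nhds hcH)
  filter_upwards [hev.filter_mono nhdsWithin_le_nhds, self_mem_nhdsWithin] with y hy hyS
  refine hy.trans_le ?_
  rw [← hfk y hyS]
  exact ofReal_collisionDual_le_Q2 hα (hf y hyS) hH

end CollisionEntropy

/-! ### Existence of the minimizing state -/

section Minimum

variable {r : Type*} [Fintype r] [DecidableEq r]

theorem isClosed_posSemidef : IsClosed {w : Matrix r r ℂ | w.PosSemidef} := by
  simp only [posSemidef_iff_dotProduct_mulVec, Set.ofPred_and, Set.ofPred_forall]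
  refine IsClosed.inter (isClosed_eq (continuous_id.matrix_conjTranspose) continuous_id)
    (isClosed_iInter fun x => ?_)
  refine isClosed_le continuous_const ?_
  exact Continuous.dotProduct continuous_const (continuous_id.matrix_mulVec continuous_const)

theorem isCompact_posSemidef_sqrt_density :
    IsCompact {w : Matrix r r ℂ | w.PosSemidef ∧ (w * w).trace = 1} := by
  have hK : IsCompact (Set.univ.pi fun _ : r => Set.univ.pi fun _ : r =>
      Metric.closedBall (0 : ℂ) 1) :=
    isCompact_univ_pi fun _ => isCompact_univ_pi fun _ => isCompact_closedBall _ _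
  refine hK.of_isClosed_subset (isClosed_posSemidef.inter (isClosed_eq
    (Continuous.matrix_trace (continuous_id.matrix_mul continuous_id)) continuous_const)) ?_
  rintro w ⟨hw, htr⟩ i - j -
  have h := trace_conjTranspose_mul_self_re w
  rw [hw.1, htr, Complex.one_re] at h
  have h1 := Finset.single_le_sum (f := fun p : r × r => ‖w p.1 p.2‖ ^ 2)
    (fun _ _ => by positivity) (Finset.mem_univ (i, j))
  rw [← h] at h1
  rw [mem_closedBall_zero_iff]
  exact (sq_le_one_iff₀ (norm_nonneg _)).1 h1

theorem IsDensity.sqrt_mul_sqrt {ω : Matrix r r ℂ} (hω : IsDensity ω) :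
    ω ^ (1 / 2 : ℝ) * ω ^ (1 / 2 : ℝ) = ω := by
  rw [rpow_mul_rpow hω.1 (add_halves 1) one_ne_zero, rpow_one hω.1]

theorem mul_self_posSemidef {w : Matrix r r ℂ} (hw : w.PosSemidef) : (w * w).PosSemidef := by
  have := posSemidef_conjTranspose_mul_self w
  rwa [hw.1] at this

theorem mul_self_rpow_half {w : Matrix r r ℂ} (hw : w.PosSemidef) :
    (w * w) ^ (1 / 2 : ℝ) = w := by
  rw [← sqrt_eq_rpow, CFC.sqrt_mul_self w hw.nonneg]

variable {a : Type*} [Fintype a] [DecidableEq a] {n : ℕ} {ρ : Matrix (r × a) (r × a) ℂ}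
  {σ : Matrix a a ℂ}

theorem exists_density_splitValue_le (hn : 1 ≤ n) (hρ : IsDensity ρ) (hσ : IsDensity σ) :
    ∃ ω : Matrix r r ℂ, IsDensity ω ∧
      ∀ ω', IsDensity ω' → splitValue n ρ σ ω ≤ splitValue n ρ σ ω' := by
  -- States are parametrized as `ω = w * w`, so that the square root of `ω` is the variable itself.
  set W := {w : Matrix r r ℂ | w.PosSemidef ∧ (w * w).trace = 1} with hW
  have hn0 : (n : ℝ≥0∞) ≠ 0 := by exact_mod_cast (by omega : n ≠ 0)
  have hne : W.Nonempty :=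
    ⟨marginal ρ ^ (1 / 2 : ℝ), posSemidef_rpow _ _, by
      rw [hρ.marginal.sqrt_mul_sqrt, hρ.marginal.2]⟩
  have h1 : LowerSemicontinuousOn (fun w => Q2 (marginal ρ) (w * w)) W :=
    lowerSemicontinuousOn_Q2 hρ.marginal.1 (fun w hw => mul_self_posSemidef hw.1)
      (fun w hw => mul_self_rpow_half hw.1) continuous_id
  have h2 : LowerSemicontinuousOn (fun w => Q2 ρ ((w * w) ⊗ₖ σ)) W := by
    refine lowerSemicontinuousOn_Q2 (k := fun w => w ⊗ₖ (σ ^ (1 / 2 : ℝ))) hρ.1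
      (fun w hw => (mul_self_posSemidef hw.1).kronecker hσ.1) (fun w hw => ?_) ?_
    · rw [kronecker_rpow (mul_self_posSemidef hw.1) hσ.1, mul_self_rpow_half hw.1]
    · refine continuous_matrix fun p q => ?_
      exact (continuous_id.matrix_elem _ _).mul continuous_const
  -- Only finiteness of the weight is needed; for `n = 1` the first weight is zero and `0 * ⊤ = 0`.
  have hmul : ∀ c : ℝ≥0∞, c ≠ ⊤ → ∀ f : Matrix r r ℂ → ℝ≥0∞, LowerSemicontinuousOn f W →
      LowerSemicontinuousOn (fun w => c * f w) W := fun c hc f hf =>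
    (ENNReal.continuous_const_mul hc).comp_lowerSemicontinuousOn hf fun _ _ h =>
      mul_le_mul_right h c
  have h3 : LowerSemicontinuousOn (fun w => splitValue n ρ σ (w * w)) W :=
    (hmul _ (ENNReal.div_ne_top (ENNReal.sub_ne_top (ENNReal.natCast_ne_top n)) hn0) _ h1).add
      (hmul _ (ENNReal.div_ne_top ENNReal.one_ne_top hn0) _ h2)
  obtain ⟨w, hw, hmin⟩ := h3.exists_isMinOn hne isCompact_posSemidef_sqrt_density
  refine ⟨w * w, ⟨mul_self_posSemidef hw.1, hw.2⟩, fun ω' hω' => ?_⟩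
  have := hmin (a := ω' ^ (1 / 2 : ℝ))
    ⟨posSemidef_rpow _ _, by rw [hω'.sqrt_mul_sqrt, hω'.2]⟩
  simpa only [Set.mem_ofPred_eq, hω'.sqrt_mul_sqrt] using this

theorem isLeast_nu (hn : 1 ≤ n) (hρ : IsDensity ρ) (hσ : IsDensity σ) :
    IsLeast (splitValue n ρ σ '' {ω : Matrix r r ℂ | IsDensity ω}) (nu n ρ σ) := by
  obtain ⟨ω, hω, hmin⟩ := exists_density_splitValue_le hn hρ hσ
  have : nu n ρ σ = splitValue n ρ σ ω :=
    le_antisymm (iInf₂_le ω hω) (le_iInf₂ hmin)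
  refine ⟨⟨ω, hω, this.symm⟩, ?_⟩
  rintro _ ⟨ω', hω', rfl⟩
  exact iInf₂_le ω' hω'

end Minimum

/-! ### Bounds on the purified distance -/

section Bounds

variable {r a : Type*} [Fintype r] [DecidableEq r] [Fintype a] [DecidableEq a] {n : ℕ}
  {ρ : Matrix (r × a) (r × a) ℂ} {σ : Matrix a a ℂ}

/-- A finite `splitValue` is the collision quantity of `τ` relative to `ω ⊗ σ^{⊗n}`. -/
theorem splitValue_eq_ofReal (hn : 1 ≤ n) (hρ : IsDensity ρ) (hσ : IsDensity σ)
    {ω : Matrix r r ℂ} (hω : IsDensity ω) (h : suppProj (ω ⊗ₖ σ) * ρ = ρ) :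
    splitValue n ρ σ ω = ENNReal.ofReal
      ((ω ⊗ₖ tensorPow n σ) ^ (-1 / 2 : ℝ) * tau n ρ σ * (ω ⊗ₖ tensorPow n σ) ^ (-1 / 2 : ℝ) *
        tau n ρ σ).trace.re := by
  have hn0 : (0 : ℝ) < n := by exact_mod_cast hn
  have hn1 : (1 : ℝ) ≤ n := by exact_mod_cast hn
  have hp := trace_collision_nonneg hρ.marginal.1 hω.1
  have hq := trace_collision_nonneg hρ.1 (hω.kronecker hσ).1
  rw [trace_tau_collision hn hω.1 hσ h, splitValue,
    Q2_of_supported hω.1 (suppProj_mul_marginal hω.1 hσ.1 h),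
    Q2_of_supported (hω.kronecker hσ).1 h, ENNReal.ofReal_add
      (mul_nonneg (div_nonneg (by linarith) hn0.le) hp) (mul_nonneg (by positivity) hq),
    ENNReal.ofReal_mul (div_nonneg (by linarith) hn0.le), ENNReal.ofReal_mul (by positivity),
    ENNReal.ofReal_div_of_pos hn0, ENNReal.ofReal_div_of_pos hn0,
    ENNReal.ofReal_sub _ zero_le_one, ENNReal.ofReal_natCast, ENNReal.ofReal_one]

/-- The weight `1 / n` is nonzero, so finiteness of the sum forces the `RA` term to be finite. -/
theorem suppProj_mul_of_splitValue_ne_top (hσ : IsDensity σ) {ω : Matrix r r ℂ}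
    (hω : IsDensity ω) (h : splitValue n ρ σ ω ≠ ⊤) : suppProj (ω ⊗ₖ σ) * ρ = ρ := by
  refine suppProj_mul_of_Q2_ne_top (hω.kronecker hσ).1 fun hQ => h ?_
  rw [splitValue, hQ, ENNReal.mul_top (by simp), add_top]

/-- The overlap of the convex-split state with the product state. -/
noncomputable def overlap (n : ℕ) (ρ : Matrix (r × a) (r × a) ℂ) (σ : Matrix a a ℂ) : ℝ :=
  (tau n ρ σ ^ (1 / 2 : ℝ) * (marginal ρ ⊗ₖ tensorPow n σ) ^ (1 / 2 : ℝ)).trace.re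

theorem overlap_nonneg (hn : 1 ≤ n) (hρ : IsDensity ρ) (hσ : IsDensity σ) :
    0 ≤ overlap n ρ σ :=
  trace_rpow_mul_rpow_nonneg (hρ.tau hn hσ).1 (hρ.marginal.kronecker (hσ.tensorPow n)).1
    (by norm_num) (by norm_num)

theorem overlap_le_one (hn : 1 ≤ n) (hρ : IsDensity ρ) (hσ : IsDensity σ) :
    overlap n ρ σ ≤ 1 :=
  trace_half_mul_half_le_one (hρ.tau hn hσ) (hρ.marginal.kronecker (hσ.tensorPow n))

theorem overlap_le_fidelity :
    overlap n ρ σ ≤ fidelity (tau n ρ σ) (marginal ρ ⊗ₖ tensorPow n σ) := by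
  rw [fidelity, sqrt_eq_rpow, sqrt_eq_rpow]
  exact trace_re_le_traceNorm _

theorem one_le_overlap_sq_mul_toReal (hn : 1 ≤ n) (hρ : IsDensity ρ) (hσ : IsDensity σ)
    {ω : Matrix r r ℂ} (hω : IsDensity ω) (h : splitValue n ρ σ ω ≠ ⊤) :
    1 ≤ overlap n ρ σ ^ 2 * (splitValue n ρ σ ω).toReal := by
  have hs := suppProj_mul_of_splitValue_ne_top hσ hω h
  have hσn := hσ.tensorPow n
  have hτ := hρ.tau hn hσ
  rw [splitValue_eq_ofReal hn hρ hσ hω hs,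
    ENNReal.toReal_ofReal (trace_collision_nonneg hτ.1 (hω.kronecker hσn).1)]
  have := one_le_overlap_mul_collision hτ hω hσn (suppProj_mul_tau hω.1 hσ.1 hσn.1 hs)
  rwa [marginal_tau hn hσ.2] at this

theorem one_le_nu (hn : 1 ≤ n) (hρ : IsDensity ρ) (hσ : IsDensity σ) : 1 ≤ nu n ρ σ := by
  refine le_iInf₂ fun ω hω => ?_
  by_cases h : splitValue n ρ σ ω = ⊤
  · rw [h]; exact le_top
  have h1 := one_le_overlap_sq_mul_toReal hn hρ hσ hω h
  have h2 : overlap n ρ σ ^ 2 ≤ 1 :=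
    pow_le_one₀ (overlap_nonneg hn hρ hσ) (overlap_le_one hn hρ hσ)
  have h3 : 1 ≤ (splitValue n ρ σ ω).toReal := by
    nlinarith [ENNReal.toReal_nonneg (a := splitValue n ρ σ ω)]
  rw [← ENNReal.ofReal_toReal h]
  exact ENNReal.one_le_ofReal.2 h3

theorem purifiedDist_sq_le_one_sub {ι : Type*} [Fintype ι] [DecidableEq ι] {α β : Matrix ι ι ℂ}
    {x : ℝ} (hx : x ≤ 1) (h : x ≤ fidelity α β ^ 2) : purifiedDist α β ^ 2 ≤ 1 - x := by
  rw [purifiedDist]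
  rcases le_total 0 (1 - fidelity α β ^ 2) with h0 | h0
  · rw [Real.sq_sqrt h0]; linarith
  -- Here the real square root is zero and `x ≤ 1` suffices, so `F ≤ 1` never has to be proved.
  · rw [Real.sqrt_eq_zero_of_nonpos h0]; linarith

theorem purifiedDist_sq_le_one_sub_inv_splitValue (hn : 1 ≤ n) (hρ : IsDensity ρ)
    (hσ : IsDensity σ) {ω : Matrix r r ℂ} (hω : IsDensity ω) :
    purifiedDist (tau n ρ σ) (marginal ρ ⊗ₖ tensorPow n σ) ^ 2 ≤
      1 - (1 / splitValue n ρ σ ω).toReal := by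
  by_cases h : splitValue n ρ σ ω = ⊤
  · rw [h, ENNReal.div_top, ENNReal.toReal_zero]
    exact purifiedDist_sq_le_one_sub zero_le_one (sq_nonneg _)
  have h1 := one_le_overlap_sq_mul_toReal hn hρ hσ hω h
  have hG := overlap_nonneg hn hρ hσ
  have h2 : 0 < (splitValue n ρ σ ω).toReal :=
    lt_of_le_of_ne ENNReal.toReal_nonneg fun h0 => by rw [← h0, mul_zero] at h1; linarith
  have h3 : (1 / splitValue n ρ σ ω).toReal ≤ overlap n ρ σ ^ 2 := by
    rw [ENNReal.toReal_div, ENNReal.toReal_one, div_le_iff₀ h2]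
    exact h1
  exact purifiedDist_sq_le_one_sub (h3.trans (pow_le_one₀ hG (overlap_le_one hn hρ hσ)))
    (h3.trans (pow_le_pow_left₀ hG overlap_le_fidelity 2))

theorem splitValue_marginal_toReal (hn : 1 ≤ n) (hρ : IsDensity ρ)
    (h : Q2 ρ (marginal ρ ⊗ₖ σ) ≠ ⊤) :
    (splitValue n ρ σ (marginal ρ)).toReal = (mu ρ σ + n) / n := by
  have hn0 : (n : ℝ≥0∞) ≠ 0 := by exact_mod_cast (by omega : n ≠ 0)
  have hn1 : (1 : ℝ≥0∞) ≤ n := by exact_mod_cast hn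
  have hnR : (n : ℝ) ≠ 0 := by exact_mod_cast (by omega : n ≠ 0)
  rw [splitValue, Q2_self hρ.marginal, mul_one, ENNReal.toReal_add
    (ENNReal.div_ne_top (ENNReal.sub_ne_top (ENNReal.natCast_ne_top n)) hn0)
    (ENNReal.mul_ne_top (ENNReal.div_ne_top ENNReal.one_ne_top hn0) h), ENNReal.toReal_mul,
    ENNReal.toReal_div, ENNReal.toReal_div, ENNReal.toReal_sub_of_le hn1
    (ENNReal.natCast_ne_top n), ENNReal.toReal_one, ENNReal.toReal_natCast, mu]
  field_simp
  ring

theorem purifiedDist_sq_le_mu_div (hn : 1 ≤ n) (hρ : IsDensity ρ) (hσ : IsDensity σ)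
    (h : Q2 ρ (marginal ρ ⊗ₖ σ) ≠ ⊤) :
    purifiedDist (tau n ρ σ) (marginal ρ ⊗ₖ tensorPow n σ) ^ 2 ≤ mu ρ σ / (mu ρ σ + n) := by
  have hnR : (0 : ℝ) < n := by exact_mod_cast hn
  have hv := splitValue_marginal_toReal hn hρ h
  have h1 : 1 ≤ splitValue n ρ σ (marginal ρ) :=
    (one_le_nu hn hρ hσ).trans (iInf₂_le (marginal ρ) hρ.marginal)
  have htop : splitValue n ρ σ (marginal ρ) ≠ ⊤ := by
    rw [splitValue, Q2_self hρ.marginal, mul_one]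
    have hn0 : (n : ℝ≥0∞) ≠ 0 := by exact_mod_cast (by omega : n ≠ 0)
    exact ENNReal.add_ne_top.2
      ⟨ENNReal.div_ne_top (ENNReal.sub_ne_top (ENNReal.natCast_ne_top n)) hn0,
        ENNReal.mul_ne_top (ENNReal.div_ne_top ENNReal.one_ne_top hn0) h⟩
  -- The bound `1 ≤ ν_n` yields `μ ≥ 0`, which makes the denominator `μ + n` positive.
  have h2 : 1 ≤ (mu ρ σ + n) / n := by
    rw [← hv, ← ENNReal.toReal_one]
    exact ENNReal.toReal_mono htop h1
  have h3 : 0 < mu ρ σ + n := by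
    rw [one_le_div hnR] at h2; linarith
  refine (purifiedDist_sq_le_one_sub_inv_splitValue hn hρ hσ hρ.marginal).trans (le_of_eq ?_)
  rw [ENNReal.toReal_div, ENNReal.toReal_one, hv]
  field_simp
  ring

end Bounds

end ConvexSplit

theorem corollary1 {r a : Type*} [Fintype r] [DecidableEq r] [Fintype a] [DecidableEq a]
    (n : ℕ) (hn : 1 ≤ n)
    (ρ : Matrix (r × a) (r × a) ℂ) (hρ : ConvexSplit.IsDensity ρ)
    (σ : Matrix a a ℂ) (hσ : ConvexSplit.IsDensity σ) :
    -- `ν_n` is a minimum, and it is at least `1`, so that `1 / ν_n` is a real number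
    IsLeast (ConvexSplit.splitValue n ρ σ '' {ω : Matrix r r ℂ | ConvexSplit.IsDensity ω})
      (ConvexSplit.nu n ρ σ) ∧
    1 ≤ ConvexSplit.nu n ρ σ ∧
    ConvexSplit.purifiedDist (ConvexSplit.tau n ρ σ)
        (ConvexSplit.marginal ρ ⊗ₖ ConvexSplit.tensorPow n σ) ^ 2
      ≤ 1 - (1 / ConvexSplit.nu n ρ σ).toReal ∧
    (ConvexSplit.Q2 ρ (ConvexSplit.marginal ρ ⊗ₖ σ) ≠ ⊤ →
      ConvexSplit.purifiedDist (ConvexSplit.tau n ρ σ)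
          (ConvexSplit.marginal ρ ⊗ₖ ConvexSplit.tensorPow n σ) ^ 2
        ≤ ConvexSplit.mu ρ σ / (ConvexSplit.mu ρ σ + n)) := by
  obtain ⟨ω, hω, h⟩ := (ConvexSplit.isLeast_nu hn hρ hσ).1
  refine ⟨ConvexSplit.isLeast_nu hn hρ hσ, ConvexSplit.one_le_nu hn hρ hσ, ?_,
    ConvexSplit.purifiedDist_sq_le_mu_div hn hρ hσ⟩
  rw [← h]
  exact ConvexSplit.purifiedDist_sq_le_one_sub_inv_splitValue hn hρ hσ hω
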